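/- Let $1\le p_0<p_1<\infty$ and $1\le q_0<q_1<\infty$ with $p_0\le q_0$ and $p_1\le q_1$. There is a constant $C=C(p_0,p_1,q_0,q_1)\in(0,\infty)$ with the following property. Let $(X,\mathcal A,\mu)$ and $(Y,\mathcal B,\nu)$ be $\sigma$-finite measure spaces and let $T$ be a linear operator from the real measurable functions on $X$ to the real measurable functions on $Y$ (functions being identified when they agree almost everywhere). For a measurable function $f$ let $f^*(t)=\inf\{s\ge 0:\mu\{|f|>s\}\le t\}$, and let $$|f|_{p,1}=\int_0^\infty t^{1/p}f^*(t)\,\frac{dt}{t},\qquad |f|_{p,\infty}=\sup_{t>0}t^{1/p}f^*(t)$$ be the Lorentz norms (and similarly on $Y$). Suppose that $T$ is simultaneously of weak types $(p_0,q_0)$ and $(p_1,q_1)$ in the Lorentz sense, with constants $M_0,M_1\in[0,\infty)$: $$|Tf|_{q_i,\infty}\le M_i\,|f|_{p_i,1}\quad\text{for all } f \text{ with } |f|_{p_i,1}<\infty,\qquad i=0,1.$$ Let $\psi$ be a continuous function on the open interval $(p_0,p_1)$ with $\inf_{(p_0,p_1)}\psi>0$, and for $q\in(q_0,q_1)$ put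 $$r_{RT}(q)=\frac{p_0p_1(q_1-q_0)q}{p_0q_1(q-q_0)+p_1q_0(q_1-q)},\qquad \psi_M(q)=\frac{\psi(r_{RT}(q))}{(q-q_0)(q_1-q)}.$$ Then for every measurable $f$ on $X$ with $\|f\|_{G\psi}:=\sup_{p\in(p_0,p_1)}|f|_p/\psi(p)<\infty$, where $|\cdot|_p$ denotes the $L_p$ norm, $$\|Tf\|_{G\psi_M}:=\sup_{q\in(q_0,q_1)}\frac{|Tf|_q}{\psi_M(q)}\;\le\; C\,\max(M_0,M_1)\,\|f\|_{G\psi}.$$ -/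

import Mathlib

open MeasureTheory
open scoped ENNReal NNReal

noncomputable section

/-- The class `Ψ(A, B)`: functions that are continuous on the open interval `(A, B)` and bounded
below there by a positive constant. (By convention `ψ = ∞` off `(A, B)`; the values of `ψ` off
the interval are never used.) -/
structure IsPsiFunction (A B : ℝ) (ψ : ℝ → ℝ) : Prop where
  continuousOn : ContinuousOn ψ (Set.Ioo A B)
  exists_pos_le : ∃ c : ℝ, 0 < c ∧ ∀ p ∈ Set.Ioo A B, c ≤ ψ p

/-- The norm `‖f‖_{G(ψ; A, B)} = sup_{p ∈ (A, B)} |f|_p / ψ(p)` of the Grand Lebesgue Space. -/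
def glsNorm {X : Type*} [MeasurableSpace X] (A B : ℝ) (ψ : ℝ → ℝ) (f : X → ℝ)
    (μ : Measure X) : ℝ≥0∞ :=
  ⨆ p ∈ Set.Ioo A B, eLpNorm f (ENNReal.ofReal p) μ / ENNReal.ofReal (ψ p)

/-- The decreasing rearrangement `f^*(t) = inf {s ≥ 0 : μ {|f| > s} ≤ t}`, the generalized
inverse of the distribution function of `|f|`. -/
def decreasingRearrangement {X : Type*} [MeasurableSpace X] (f : X → ℝ) (μ : Measure X)
    (t : ℝ) : ℝ≥0∞ :=
  sInf {s : ℝ≥0∞ | μ {x | s < ‖f x‖ₑ} ≤ ENNReal.ofReal t}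

/-- The Lorentz (quasi-)norm `|f|_{p,q}`: `(∫₀^∞ (t^{1/p} f^*(t))^q dt/t)^{1/q}` for `q < ∞`, and
`sup_{t > 0} t^{1/p} f^*(t)` for `q = ∞`. -/
def lorentzNorm {X : Type*} [MeasurableSpace X] (f : X → ℝ) (p q : ℝ≥0∞)
    (μ : Measure X) : ℝ≥0∞ :=
  if q = ∞ then
    ⨆ t ∈ Set.Ioi (0 : ℝ), ENNReal.ofReal (t ^ (1 / p.toReal)) * decreasingRearrangement f μ t
  else
    (∫⁻ t in Set.Ioi (0 : ℝ),
      (ENNReal.ofReal (t ^ (1 / p.toReal)) * decreasingRearrangement f μ t) ^ q.toReal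
        / ENNReal.ofReal t) ^ (1 / q.toReal)

/-- `T` is of weak type `(p, q)` in the Lorentz sense, with constant `M`:
`|T f|_{q,∞} ≤ M |f|_{p,1}` for all `f ∈ L_{p,1}`. -/
def IsWeakType {X Y : Type*} [MeasurableSpace X] [MeasurableSpace Y] {μ : Measure X}
    {ν : Measure Y} (T : (X →ₘ[μ] ℝ) →ₗ[ℝ] (Y →ₘ[ν] ℝ)) (p q : ℝ) (M : ℝ≥0) : Prop :=
  ∀ f : X →ₘ[μ] ℝ, lorentzNorm f (ENNReal.ofReal p) 1 μ < ∞ →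
    lorentzNorm (T f) (ENNReal.ofReal q) ∞ ν ≤ M * lorentzNorm f (ENNReal.ofReal p) 1 μ

/-- `r_RT(q)`, the exponent `p` with `1/p = (1-θ)/p₀ + θ/p₁` where `1/q = (1-θ)/q₀ + θ/q₁`. -/
def rRT (p₀ p₁ q₀ q₁ q : ℝ) : ℝ :=
  p₀ * p₁ * (q₁ - q₀) * q / (p₀ * q₁ * (q - q₀) + p₁ * q₀ * (q₁ - q))

/-- `ψ_M(q) = ψ(r_RT(q)) [(q - q₀)(q₁ - q)]⁻¹`. -/
def psiM (p₀ p₁ q₀ q₁ : ℝ) (ψ : ℝ → ℝ) (q : ℝ) : ℝ :=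
  ψ (rRT p₀ p₁ q₀ q₁ q) * ((q - q₀) * (q₁ - q))⁻¹

end

/-! This is Marcinkiewicz interpolation with the constant tracked as q approaches an endpoint. Fix
q, let p = r_RT(q), and let β be the slope of the line through the points (1/q_i, 1/p_i). Truncating
f at height f*(2^k) and applying the two weak types bounds (Tf)*(2·2^(βk)) by a left and a right
dyadic sum of f* (`decreasingRearrangement_two_mul_le_of_isWeakType`). After multiplication by
2^(βk/q) both sums are dominated by the convolution of 2^(j/p) f*(2^j) with the kernel 2^(-α|n|),
for any α ≤ 1 below both 1/p₀ - 1/p and 1/p - 1/p₁.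

Young's inequality costs only the ℓ¹ norm of the kernel, at most 4/α, and p ≤ q allows passing from
ℓ^p to ℓ^q. Hence |Tf|_q ≤ (C/α) max(M₀, M₁) |f|_p (`eLpNorm_le_of_isWeakType`). Since α can be a
fixed multiple of (q - q₀)(q₁ - q), the loss is exactly the extra factor in ψ_M, and |f|_p ≤ ψ(p)
‖f‖ finishes. -/

/-! ### Decreasing rearrangements -/

section Rearrangement

variable {X : Type*} [MeasurableSpace X] {μ : Measure X}

/-- The distribution function is right-continuous, by continuity of measure along increasing unions,
so the infimum defining f* is attained. -/
theorem decreasingRearrangement_le_iff {f : X → ℝ} {t : ℝ} {s : ℝ≥0∞} :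
    decreasingRearrangement f μ t ≤ s ↔ μ {x | s < ‖f x‖ₑ} ≤ ENNReal.ofReal t := by
  refine ⟨fun h => ?_, fun h => sInf_le h⟩
  rcases eq_or_ne s ∞ with rfl | hs
  · simp
  obtain ⟨u, hu, hsu, hlim⟩ := exists_seq_strictAnti_tendsto' (lt_top_iff_ne_top.2 hs)
  have hset : {x | s < ‖f x‖ₑ} = ⋃ n, {x | u n < ‖f x‖ₑ} := by
    ext x
    simp only [Set.mem_ofPred_eq, Set.mem_iUnion]
    constructor
    · intro hx
      exact (hlim.eventually_lt_const hx).exists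
    · rintro ⟨n, hn⟩
      exact (hsu n).1.trans hn
  have hmono : Monotone fun n => {x | u n < ‖f x‖ₑ} := fun m n hmn x hx =>
    (hu.antitone hmn).trans_lt hx
  rw [hset, hmono.measure_iUnion]
  refine iSup_le fun n => ?_
  obtain ⟨s', hs', hlt⟩ := sInf_lt_iff.1 (h.trans_lt (hsu n).1)
  exact (measure_mono fun x hx => hlt.trans hx).trans hs'

theorem lt_decreasingRearrangement_iff {f : X → ℝ} {t : ℝ} {s : ℝ≥0∞} :
    s < decreasingRearrangement f μ t ↔ ENNReal.ofReal t < μ {x | s < ‖f x‖ₑ} := by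
  rw [← not_le, decreasingRearrangement_le_iff, not_le]

theorem antitone_decreasingRearrangement (f : X → ℝ) :
    Antitone (decreasingRearrangement f μ) := fun _ _ hst =>
  decreasingRearrangement_le_iff.2
    ((decreasingRearrangement_le_iff.1 le_rfl).trans (ENNReal.ofReal_le_ofReal hst))

theorem decreasingRearrangement_mono_ae {f g : X → ℝ} (h : ∀ᵐ x ∂μ, ‖f x‖ₑ ≤ ‖g x‖ₑ) (t : ℝ) :
    decreasingRearrangement f μ t ≤ decreasingRearrangement g μ t := by
  refine decreasingRearrangement_le_iff.2
    ((measure_mono_ae ?_).trans ((decreasingRearrangement_le_iff (f := g)).1 le_rfl))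
  filter_upwards [h] with x hx hlt
  exact lt_of_lt_of_le hlt hx

theorem decreasingRearrangement_add_le (f g : X → ℝ) {s t : ℝ} (hs : 0 ≤ s) (ht : 0 ≤ t) :
    decreasingRearrangement (f + g) μ (s + t)
      ≤ decreasingRearrangement f μ s + decreasingRearrangement g μ t := by
  rw [decreasingRearrangement_le_iff, ENNReal.ofReal_add hs ht]
  refine le_trans (measure_mono ?_) ((measure_union_le
    {x | decreasingRearrangement f μ s < ‖f x‖ₑ} {x | decreasingRearrangement g μ t < ‖g x‖ₑ}).trans
    (add_le_add (decreasingRearrangement_le_iff.1 le_rfl) (decreasingRearrangement_le_iff.1 le_rfl)))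
  intro x hx
  by_contra hcon
  simp only [Set.mem_union, Set.mem_ofPred_eq, not_or, not_lt] at hcon hx
  exact absurd ((enorm_add_le _ _).trans (add_le_add hcon.1 hcon.2)) (not_le.2 hx)

end Rearrangement

/-! ### Comparing integrals through distribution functions -/

section LayerCake

variable {X Y : Type*} [MeasurableSpace X] [MeasurableSpace Y] {μ : Measure X} {ν : Measure Y}

theorem lintegral_min_natCast_eq_lintegral_measure_lt {f : X → ℝ≥0∞} (hf : AEMeasurable f μ)
    (n : ℕ) : ∫⁻ x, min (f x) n ∂μ
      = ∫⁻ t in Set.Ioi (0 : ℝ), μ {x | ENNReal.ofReal t < min (f x) n} := by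
  have hfin : ∀ z, min (f z) n ≠ ∞ := fun z => ne_top_of_le_ne_top (by simp) (min_le_right _ _)
  have := lintegral_eq_lintegral_meas_lt μ (f := fun z => (min (f z) n).toReal)
    (Filter.Eventually.of_forall fun _ => ENNReal.toReal_nonneg)
    (hf.min aemeasurable_const).ennreal_toReal
  simp only [ENNReal.ofReal_toReal (hfin _)] at this
  rw [this]
  refine setLIntegral_congr_fun measurableSet_Ioi fun t ht => ?_
  simp only [ENNReal.ofReal_lt_iff_lt_toReal (le_of_lt ht) (hfin _)]

/-- Layer cake on truncations, then monotone convergence. The two measure spaces may differ: one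
will be ℤ with weights, which turns L^p integrals into dyadic sums. -/
theorem lintegral_le_mul_lintegral_of_measure_lt_le {f : X → ℝ≥0∞} {g : Y → ℝ≥0∞} (c : ℝ≥0)
    (hf : AEMeasurable f μ) (hg : AEMeasurable g ν)
    (h : ∀ s : ℝ≥0∞, μ {x | s < f x} ≤ c * ν {y | s < g y}) :
    ∫⁻ x, f x ∂μ ≤ c * ∫⁻ y, g y ∂ν := by
  have hsup : ∀ a : ℝ≥0∞, a = ⨆ n : ℕ, min a n := by
    intro a
    refine le_antisymm ?_ (iSup_le fun n => min_le_left _ _)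
    rw [← inf_iSup_eq, ENNReal.iSup_natCast]
    simp
  calc ∫⁻ x, f x ∂μ = ∫⁻ x, ⨆ n : ℕ, min (f x) n ∂μ := lintegral_congr fun x => hsup _
    _ = ⨆ n : ℕ, ∫⁻ x, min (f x) n ∂μ := by
      refine lintegral_iSup' (fun n => hf.min aemeasurable_const)
        (Filter.Eventually.of_forall fun x m n hmn => ?_)
      exact min_le_min le_rfl (by exact_mod_cast hmn)
    _ ≤ c * ∫⁻ y, g y ∂ν := by
      refine iSup_le fun n => ?_
      refine le_trans ?_ (mul_le_mul_right (lintegral_mono fun y => min_le_left (g y) n) _)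
      rw [lintegral_min_natCast_eq_lintegral_measure_lt hf,
        lintegral_min_natCast_eq_lintegral_measure_lt hg, ← lintegral_const_mul' _ _ ENNReal.coe_ne_top]
      refine lintegral_mono fun t => ?_
      by_cases ht : ENNReal.ofReal t < n
      · simpa [ht] using h (ENNReal.ofReal t)
      · simp [ht]

theorem lintegral_rpow_le_mul_lintegral_rpow_of_measure_lt_le {f : X → ℝ≥0∞} {g : Y → ℝ≥0∞}
    (c : ℝ≥0) {p : ℝ} (hp : 0 < p) (hf : AEMeasurable f μ) (hg : AEMeasurable g ν)
    (h : ∀ s : ℝ≥0∞, μ {x | s < f x} ≤ c * ν {y | s < g y}) :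
    ∫⁻ x, f x ^ p ∂μ ≤ c * ∫⁻ y, g y ^ p ∂ν := by
  refine lintegral_le_mul_lintegral_of_measure_lt_le c (hf.pow_const p) (hg.pow_const p) fun s => ?_
  have := h (s ^ p⁻¹)
  have key : ∀ a : ℝ≥0∞, s ^ p⁻¹ < a ↔ s < a ^ p := fun a => by
    rw [ENNReal.rpow_inv_lt_iff hp]
  simpa only [key] using this

end LayerCake

/-! ### Dyadic sums and dyadic discretization of norms -/

section Dyadic

theorem ENNReal.two_rpow_add (x y : ℝ) : (2 : ℝ≥0∞) ^ (x + y) = 2 ^ x * 2 ^ y :=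
  ENNReal.rpow_add _ _ (by simp) (by simp)

theorem ENNReal.ofReal_two_rpow (x : ℝ) : ENNReal.ofReal ((2 : ℝ) ^ x) = 2 ^ x := by
  rw [← ENNReal.ofReal_rpow_of_pos (by norm_num)]
  simp

theorem ENNReal.tsum_two_rpow_neg_mul_le {α : ℝ} (h0 : 0 < α) (h1 : α ≤ 1) :
    ∑' n : ℕ, (2 : ℝ≥0∞) ^ (-(α * n)) ≤ ENNReal.ofReal (2 / α) := by
  -- Bernoulli for the exponent α ≤ 1, applied to (1 - 1/2)^α; it makes the geometric sum O(1/α).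
  have hr : (2 : ℝ) ^ (-α) ≤ 1 - α / 2 := by
    have h := rpow_one_add_le_one_add_mul_self (s := -(1 / 2)) (by norm_num) h0.le h1
    rw [Real.rpow_neg (by norm_num), ← Real.inv_rpow (by norm_num)]
    norm_num at h ⊢
    linarith
  have hr0 : (0 : ℝ) < (2 : ℝ) ^ (-α) := by positivity
  have hterm : ∀ n : ℕ, (2 : ℝ≥0∞) ^ (-(α * n)) = ENNReal.ofReal ((2 : ℝ) ^ (-α)) ^ n := by
    intro n
    rw [ENNReal.ofReal_two_rpow, ← ENNReal.rpow_natCast, ← ENNReal.rpow_mul]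
    congr 1
    ring
  simp_rw [hterm]
  rw [ENNReal.tsum_geometric, ← ENNReal.ofReal_one, ← ENNReal.ofReal_sub _ hr0.le,
    ← ENNReal.ofReal_inv_of_pos (by linarith)]
  refine ENNReal.ofReal_le_ofReal ?_
  rw [← inv_div]
  exact inv_anti₀ (by positivity) (by linarith)

theorem ENNReal.tsum_int_two_rpow_neg_mul_abs_le {α : ℝ} (h0 : 0 < α) (h1 : α ≤ 1) :
    ∑' n : ℤ, (2 : ℝ≥0∞) ^ (-(α * |(n : ℝ)|)) ≤ ENNReal.ofReal (4 / α) := by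
  rw [tsum_of_nat_of_neg_add_one ENNReal.summable ENNReal.summable]
  have h := ENNReal.tsum_two_rpow_neg_mul_le h0 h1
  have : ENNReal.ofReal (4 / α) = ENNReal.ofReal (2 / α) + ENNReal.ofReal (2 / α) := by
    rw [← ENNReal.ofReal_add (by positivity) (by positivity)]
    congr 1
    ring
  rw [this]
  refine add_le_add (le_trans (le_of_eq ?_) h) (le_trans (ENNReal.tsum_le_tsum fun n => ?_) h)
  · simp
  · refine ENNReal.rpow_le_rpow_of_exponent_le (by norm_num) ?_
    push_cast
    have h2 : |-((n : ℝ) + 1)| = n + 1 := by rw [abs_neg, abs_of_nonneg (by positivity)]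
    rw [h2]
    nlinarith

theorem tsum_int_le_eq_tsum_nat (a : ℤ → ℝ≥0∞) (k : ℤ) :
    ∑' j : ℤ, (if j ≤ k then a j else 0) = ∑' n : ℕ, a (k - n) := by
  have hinj : Function.Injective fun n : ℕ => k - (n : ℤ) := fun m n h => by
    simpa using h
  rw [← hinj.tsum_eq]
  · simp
  · intro j hj
    have hjk : j ≤ k := by
      by_contra hcon
      simp [hcon] at hj
    exact ⟨(k - j).toNat, by simp [Int.toNat_of_nonneg (sub_nonneg.2 hjk)]⟩

theorem tsum_int_le_two_rpow_mul_le {α : ℝ} (h0 : 0 < α) (h1 : α ≤ 1) (k : ℤ) :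
    ∑' j : ℤ, (if j ≤ k then (2 : ℝ≥0∞) ^ (α * j) else 0)
      ≤ ENNReal.ofReal (2 / α) * 2 ^ (α * k) := by
  rw [tsum_int_le_eq_tsum_nat]
  have : ∀ n : ℕ, (2 : ℝ≥0∞) ^ (α * ((k - n : ℤ) : ℝ)) = 2 ^ (-(α * n)) * 2 ^ (α * k) := by
    intro n
    rw [← ENNReal.two_rpow_add]
    congr 1
    push_cast
    ring
  simp_rw [this]
  rw [ENNReal.tsum_mul_right]
  gcongr
  exact ENNReal.tsum_two_rpow_neg_mul_le h0 h1

/-- Dyadic localization on the scale `c * 2 ^ (β * k)`. -/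
theorem ENNReal.exists_int_mul_two_rpow_lt_le {β : ℝ} (hβ : 0 < β) {c : ℝ} (hc : 0 < c)
    {d : ℝ≥0∞} (hd0 : d ≠ 0) (hd : d ≠ ∞) :
    ∃ k : ℤ, ENNReal.ofReal (c * 2 ^ (β * k)) < d ∧ d ≤ ENNReal.ofReal (c * 2 ^ (β * (k + 1))) := by
  have hpos : 0 < d.toReal := ENNReal.toReal_pos hd0 hd
  obtain ⟨k, hk1, hk2⟩ := _root_.exists_mem_Ioc_zpow (x := d.toReal / c) (y := (2 : ℝ) ^ β)
    (by positivity) (Real.one_lt_rpow (by norm_num) hβ)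
  rw [← Real.rpow_intCast, ← Real.rpow_mul (by norm_num)] at hk1 hk2
  refine ⟨k, ?_, ?_⟩
  · rw [ENNReal.ofReal_lt_iff_lt_toReal (by positivity) hd, mul_comm]
    exact (lt_div_iff₀ hc).1 hk1
  · rw [ENNReal.le_ofReal_iff_toReal_le hd (by positivity), mul_comm]
    push_cast at hk2
    exact (div_le_iff₀ hc).1 hk2

variable {X : Type*} [MeasurableSpace X] {μ : Measure X}

theorem lintegral_sum_smul_dirac (w a : ℤ → ℝ≥0∞) :
    ∫⁻ k, a k ∂(Measure.sum fun k : ℤ => w k • Measure.dirac k) = ∑' k, w k * a k := by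
  simp [lintegral_sum_measure, lintegral_smul_measure]

theorem sum_smul_dirac_apply (w : ℤ → ℝ≥0∞) (s : Set ℤ) [DecidablePred (· ∈ s)] :
    (Measure.sum fun k : ℤ => w k • Measure.dirac k) s = ∑' k, if k ∈ s then w k else 0 := by
  rw [Measure.sum_apply _ (MeasurableSet.of_discrete)]
  refine tsum_congr fun k => ?_
  by_cases hk : k ∈ s <;> simp [hk]

/-- Give k ∈ ℤ the mass 2^k. With d = μ{|f| > s}, the superlevel set of k ↦ f*(2^k) is {2^k < d}, a
geometric series of mass at most 2d. -/
theorem tsum_two_rpow_mul_decreasingRearrangement_rpow_le {f : X → ℝ} (hf : AEMeasurable f μ)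
    {p : ℝ} (hp : 0 < p) :
    ∑' k : ℤ, (2 : ℝ≥0∞) ^ (k : ℝ) * decreasingRearrangement f μ (2 ^ (k : ℝ)) ^ p
      ≤ 2 * ∫⁻ x, ‖f x‖ₑ ^ p ∂μ := by
  classical
  rw [← lintegral_sum_smul_dirac]
  refine lintegral_rpow_le_mul_lintegral_rpow_of_measure_lt_le 2 hp
    (measurable_of_countable _).aemeasurable hf.enorm fun s => ?_
  rw [sum_smul_dirac_apply]
  simp only [Set.mem_ofPred_eq, lt_decreasingRearrangement_iff, ENNReal.ofReal_two_rpow]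
  generalize μ {x | s < ‖f x‖ₑ} = d
  rcases eq_or_ne d 0 with rfl | hd0
  · simp
  rcases eq_or_ne d ∞ with rfl | hd
  · simp
  obtain ⟨n, hn1, hn2⟩ := ENNReal.exists_int_mul_two_rpow_lt_le one_pos one_pos hd0 hd
  simp only [one_mul, ENNReal.ofReal_two_rpow] at hn1 hn2
  have h1 := tsum_int_le_two_rpow_mul_le (α := 1) one_pos le_rfl n
  simp only [one_mul, div_one, ENNReal.ofReal_ofNat] at h1
  refine (ENNReal.tsum_le_tsum fun k => ?_).trans (h1.trans (mul_le_mul_right hn1.le _))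
  split_ifs with hk hkn
  · rfl
  · exfalso
    refine absurd (hk.trans_le hn2) (not_lt.2 ?_)
    refine ENNReal.rpow_le_rpow_of_exponent_le (by norm_num) ?_
    exact_mod_cast not_le.1 hkn
  · simp
  · rfl

/-- For 0 < d < ∞ a single index suffices: the last grid point below d carries as weight the next
grid point, which is at least d. -/
theorem lintegral_rpow_le_tsum_decreasingRearrangement_rpow {f : X → ℝ} (hf : AEMeasurable f μ)
    {p : ℝ} (hp : 0 < p) {β : ℝ} (hβ : 0 < β) {c : ℝ} (hc : 0 < c) :
    ∫⁻ x, ‖f x‖ₑ ^ p ∂μ ≤ ∑' k : ℤ, ENNReal.ofReal (c * 2 ^ (β * (k + 1)))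
      * decreasingRearrangement f μ (c * 2 ^ (β * k)) ^ p := by
  classical
  rw [← lintegral_sum_smul_dirac]
  conv_rhs => rw [← one_mul (lintegral _ _), ← ENNReal.coe_one]
  refine lintegral_rpow_le_mul_lintegral_rpow_of_measure_lt_le 1 hp hf.enorm
    (measurable_of_countable fun k : ℤ => decreasingRearrangement f μ (c * 2 ^ (β * k))).aemeasurable
    fun s => ?_
  rw [sum_smul_dirac_apply]
  simp only [Set.mem_ofPred_eq, lt_decreasingRearrangement_iff, ENNReal.coe_one, one_mul]
  generalize μ {x | s < ‖f x‖ₑ} = d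
  rcases eq_or_ne d 0 with rfl | hd0
  · simp
  rcases eq_or_ne d ∞ with rfl | hd
  · simp only [ENNReal.ofReal_lt_top, if_true]
    refine top_le_iff.2 (ENNReal.eq_top_of_forall_nnreal_le fun r => ?_)
    obtain ⟨n, -, hn⟩ := ENNReal.exists_int_mul_two_rpow_lt_le hβ hc
      (d := (r + 1 : ℝ≥0)) (by simp) (by simp)
    exact (by simp : (r : ℝ≥0∞) ≤ (r + 1 : ℝ≥0)).trans (hn.trans (ENNReal.le_tsum n))
  obtain ⟨n, hn1, hn2⟩ := ENNReal.exists_int_mul_two_rpow_lt_le hβ hc hd0 hd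
  refine hn2.trans (le_trans ?_ (ENNReal.le_tsum n))
  rw [if_pos hn1]

/-- On each dyadic interval both t^(1/p - 1) and f* are largest at the left end, the former because
p ≥ 1. -/
theorem lorentzNorm_one_le_tsum (f : X → ℝ) {p : ℝ} (hp : 1 ≤ p) :
    lorentzNorm f (ENNReal.ofReal p) 1 μ
      ≤ ∑' k : ℤ, (2 : ℝ≥0∞) ^ (k / p) * decreasingRearrangement f μ (2 ^ (k : ℝ)) := by
  have hp0 : 0 < p := one_pos.trans_le hp
  have hset : Set.Ioi (0 : ℝ) = ⋃ k : ℤ, Set.Ioc ((2 : ℝ) ^ (k : ℝ)) (2 ^ ((k : ℝ) + 1)) := by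
    ext t
    simp only [Set.mem_Ioi, Set.mem_iUnion]
    refine ⟨fun ht => ?_, fun ⟨k, hk⟩ => lt_trans (by positivity) hk.1⟩
    obtain ⟨k, hk⟩ := exists_mem_Ioc_zpow ht (y := (2 : ℝ)) (by norm_num)
    refine ⟨k, ?_⟩
    rw [← Real.rpow_intCast, ← Real.rpow_intCast] at hk
    exact_mod_cast hk
  simp only [lorentzNorm, ENNReal.one_ne_top, if_false, ENNReal.toReal_one, ENNReal.rpow_one,
    div_one, ENNReal.toReal_ofReal hp0.le]
  rw [hset]
  refine (lintegral_iUnion_le _ _).trans (ENNReal.tsum_le_tsum fun k => ?_)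
  have hk0 : (0 : ℝ) < 2 ^ (k : ℝ) := by positivity
  have hbound : ∀ t ∈ Set.Ioc ((2 : ℝ) ^ (k : ℝ)) (2 ^ ((k : ℝ) + 1)),
      ENNReal.ofReal (t ^ (1 / p)) * decreasingRearrangement f μ t / ENNReal.ofReal t
        ≤ 2 ^ ((k : ℝ) * (1 / p - 1)) * decreasingRearrangement f μ (2 ^ (k : ℝ)) := by
    intro t ht
    have ht0 : 0 < t := hk0.trans ht.1
    rw [ENNReal.mul_div_right_comm, ← ENNReal.ofReal_div_of_pos ht0, ← ENNReal.ofReal_two_rpow]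
    refine mul_le_mul' (ENNReal.ofReal_le_ofReal ?_) (antitone_decreasingRearrangement f ht.1.le)
    rw [← Real.rpow_sub_one ht0.ne', Real.rpow_mul (by norm_num)]
    refine Real.rpow_le_rpow_of_nonpos hk0 ht.1.le ?_
    rw [sub_nonpos, div_le_one hp0]
    exact hp
  refine (setLIntegral_mono measurable_const hbound).trans (le_of_eq ?_)
  rw [setLIntegral_const, Real.volume_Ioc, Real.rpow_add_one (by norm_num),
    show (2 : ℝ) ^ (k : ℝ) * 2 - 2 ^ (k : ℝ) = 2 ^ (k : ℝ) by ring, ENNReal.ofReal_two_rpow,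
    mul_right_comm, ← ENNReal.two_rpow_add]
  congr 2
  field_simp
  ring

end Dyadic

/-! ### Young's inequality and the embedding of ℓ^p in ℓ^q -/

section Young

/-- Hölder after the splitting w = w^(1-1/p) · w^(1/p). -/
theorem ENNReal.rpow_tsum_mul_le {ι : Type*} {p : ℝ} (hp : 1 < p) (w a : ι → ℝ≥0∞) :
    (∑' i, w i * a i) ^ p ≤ (∑' i, w i) ^ (p - 1) * ∑' i, w i * a i ^ p := by
  have hlim : Filter.Tendsto (fun s : Finset ι => (∑ i ∈ s, w i * a i) ^ p) Filter.atTop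
      (nhds ((∑' i, w i * a i) ^ p)) :=
    (ENNReal.continuous_rpow_const.tendsto _).comp ENNReal.summable.hasSum
  refine le_of_tendsto' hlim fun s => ?_
  have hp0 : 0 < p := one_pos.trans hp
  have h := ENNReal.rpow_le_rpow (ENNReal.inner_le_weight_mul_Lp_of_nonneg s hp.le w a) hp0.le
  rw [ENNReal.mul_rpow_of_nonneg _ _ hp0.le, ← ENNReal.rpow_mul, ← ENNReal.rpow_mul,
    inv_mul_cancel₀ hp0.ne', ENNReal.rpow_one,
    show (1 - p⁻¹) * p = p - 1 by field_simp] at h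
  exact h.trans (mul_le_mul' (ENNReal.rpow_le_rpow (ENNReal.sum_le_tsum s) (by linarith))
    (ENNReal.sum_le_tsum s))

/-- Young's convolution inequality `ℓ¹ * ℓᵖ → ℓᵖ` on `ℤ`. -/
theorem ENNReal.tsum_conv_rpow_le {p : ℝ} (hp : 1 < p) (w a : ℤ → ℝ≥0∞) :
    ∑' k, (∑' j, w (k - j) * a j) ^ p ≤ (∑' n, w n) ^ p * ∑' j, a j ^ p := by
  have h1 : ∀ k : ℤ, ∑' j, w (k - j) = ∑' n, w n := fun k =>
    (Equiv.subLeft k).tsum_eq w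
  have h2 : ∀ j : ℤ, ∑' k, w (k - j) = ∑' n, w n := fun j =>
    (Equiv.subRight j).tsum_eq w
  calc ∑' k, (∑' j, w (k - j) * a j) ^ p
      ≤ ∑' k, (∑' n, w n) ^ (p - 1) * ∑' j, w (k - j) * a j ^ p := by
        refine ENNReal.tsum_le_tsum fun k => ?_
        rw [← h1 k]
        exact ENNReal.rpow_tsum_mul_le hp _ _
    _ = (∑' n, w n) ^ (p - 1) * ((∑' n, w n) * ∑' j, a j ^ p) := by
        rw [ENNReal.tsum_mul_left, ENNReal.tsum_comm]
        simp_rw [ENNReal.tsum_mul_right, h2]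
        rw [ENNReal.tsum_mul_left]
    _ = (∑' n, w n) ^ p * ∑' j, a j ^ p := by
        rw [← mul_assoc]
        congr 1
        nth_rw 2 [← ENNReal.rpow_one (∑' n, w n)]
        rw [← ENNReal.rpow_add_of_nonneg _ _ (by linarith) one_pos.le, sub_add_cancel]

theorem ENNReal.tsum_rpow_le_rpow_tsum {ι : Type*} {r : ℝ} (hr : 1 ≤ r) (a : ι → ℝ≥0∞) :
    ∑' i, a i ^ r ≤ (∑' i, a i) ^ r := by
  have hle : ∀ s : Finset ι, ∑ i ∈ s, a i ^ r ≤ (∑ i ∈ s, a i) ^ r := by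
    classical
    intro s
    induction s using Finset.induction_on with
    | empty => simp [ENNReal.zero_rpow_of_pos (one_pos.trans_le hr)]
    | insert i s his ih =>
      rw [Finset.sum_insert his, Finset.sum_insert his]
      exact (add_le_add le_rfl ih).trans (ENNReal.add_rpow_le_rpow_add _ _ hr)
  refine ENNReal.summable.tsum_le_of_sum_le fun s => (hle s).trans ?_
  exact ENNReal.rpow_le_rpow (ENNReal.sum_le_tsum s) (by linarith)

end Young

/-! ### Splitting a function at a height -/

section Truncation

variable {X : Type*} [MeasurableSpace X] {μ : Measure X}

theorem MeasureTheory.AEEqFun.exists_eq_add_of_enorm_le (f : X →ₘ[μ] ℝ) (r : ℝ≥0) :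
    ∃ g h : X →ₘ[μ] ℝ, f = g + h ∧ (∀ᵐ x ∂μ, ‖g x‖ₑ ≤ ‖f x‖ₑ) ∧
      (∀ᵐ x ∂μ, ‖f x‖ₑ ≤ r → g x = 0) ∧ (∀ᵐ x ∂μ, ‖h x‖ₑ ≤ ‖f x‖ₑ) ∧ ∀ᵐ x ∂μ, ‖h x‖ₑ ≤ r := by
  have hcont : Continuous fun y : ℝ => max (-(r : ℝ)) (min y r) := by fun_prop
  -- The bounded part is f clamped to [-r, r]; continuity of the clamp lets it act on classes modulo
  -- null sets, where T is defined.
  set h := AEEqFun.comp (fun y : ℝ => max (-(r : ℝ)) (min y r)) hcont f with hh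
  have hval : ∀ᵐ x ∂μ, h x = max (-(r : ℝ)) (min (f x) r) := AEEqFun.coeFn_comp _ hcont f
  have hsub : ∀ᵐ x ∂μ, (f - h) x = f x - h x := AEEqFun.coeFn_sub f h
  have hr : (0 : ℝ) ≤ r := r.2
  have hcoe : (r : ℝ≥0∞) = ‖(r : ℝ)‖ₑ := by
    rw [Real.enorm_of_nonneg hr, ENNReal.ofReal_coe_nnreal]
  have hle : ∀ a b : ℝ, |a| ≤ |b| → ‖a‖ₑ ≤ ‖b‖ₑ := fun a b hab => by
    rw [Real.enorm_eq_ofReal_abs, Real.enorm_eq_ofReal_abs]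
    exact ENNReal.ofReal_le_ofReal hab
  refine ⟨f - h, h, (sub_add_cancel f h).symm, ?_, ?_, ?_, ?_⟩
  · filter_upwards [hval, hsub] with x hx hx'
    rw [hx', hx]
    refine hle _ _ ?_
    rcases max_cases (-(r : ℝ)) (min (f x) r) with h1 | h1 <;>
      rcases min_cases (f x) (r : ℝ) with h2 | h2 <;>
      rw [h1.1] <;> try rw [h2.1]
    all_goals
      rcases abs_cases (f x) with h3 | h3 <;> rw [abs_le] <;> constructor <;> linarith
  · filter_upwards [hval, hsub] with x hx hx' hfx
    rw [hcoe, Real.enorm_eq_ofReal_abs, Real.enorm_eq_ofReal_abs,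
      ENNReal.ofReal_le_ofReal_iff (abs_nonneg _), abs_of_nonneg hr, abs_le] at hfx
    rw [hx', hx, min_eq_left hfx.2, max_eq_right hfx.1, sub_self]
  · filter_upwards [hval] with x hx
    rw [hx]
    refine hle _ _ ?_
    rcases max_cases (-(r : ℝ)) (min (f x) r) with h1 | h1 <;>
      rcases min_cases (f x) (r : ℝ) with h2 | h2 <;>
      rw [h1.1] <;> try rw [h2.1]
    all_goals
      rcases abs_cases (f x) with h3 | h3 <;> rw [abs_le] <;> constructor <;> linarith
  · filter_upwards [hval] with x hx
    rw [hx, hcoe]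
    refine hle _ _ ?_
    rw [abs_of_nonneg hr, abs_le]
    exact ⟨le_max_left _ _, max_le (by linarith) (min_le_right _ _)⟩

end Truncation

/-! ### Calderón's estimate and strong-type interpolation -/

section WeakType

variable {X Y : Type*} [MeasurableSpace X] [MeasurableSpace Y] {μ : Measure X} {ν : Measure Y}
  {T : (X →ₘ[μ] ℝ) →ₗ[ℝ] (Y →ₘ[ν] ℝ)}

theorem IsWeakType.decreasingRearrangement_le {p q : ℝ} {M : ℝ≥0} (hT : IsWeakType T p q M)
    (hq : 0 ≤ q) {g : X →ₘ[μ] ℝ} {A : ℝ≥0∞} (hA : A ≠ ∞)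
    (hg : lorentzNorm g (ENNReal.ofReal p) 1 μ ≤ A) (x : ℝ) :
    decreasingRearrangement (T g) ν (2 ^ x) ≤ M * 2 ^ (-(x / q)) * A := by
  have h := (hT g (hg.trans_lt hA.lt_top)).trans (mul_le_mul_right hg _)
  simp only [lorentzNorm, if_true, ENNReal.toReal_ofReal hq] at h
  have hx : (2 : ℝ) ^ x ∈ Set.Ioi (0 : ℝ) := Set.mem_Ioi.2 (by positivity)
  have h2 := (le_iSup₂ (f := fun (t : ℝ) (_ : t ∈ Set.Ioi (0 : ℝ)) =>
    ENNReal.ofReal (t ^ (1 / q)) * decreasingRearrangement (T g) ν t) _ hx).trans h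
  simp only [← Real.rpow_mul zero_le_two, ENNReal.ofReal_two_rpow] at h2
  calc decreasingRearrangement (T g) ν (2 ^ x)
      = 2 ^ (-(x / q)) * (2 ^ (x * (1 / q)) * decreasingRearrangement (T g) ν (2 ^ x)) := by
        rw [← mul_assoc, ← ENNReal.two_rpow_add]
        have : -(x / q) + x * (1 / q) = 0 := by ring
        rw [this, ENNReal.rpow_zero, one_mul]
    _ ≤ 2 ^ (-(x / q)) * (M * A) := by gcongr
    _ = M * 2 ^ (-(x / q)) * A := by ring

/-- A dyadic form of Calderón's pointwise estimate for operators of two weak types. -/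
theorem decreasingRearrangement_two_mul_le_of_isWeakType {p₀ p₁ q₀ q₁ : ℝ} (hp₀ : 1 ≤ p₀)
    (hp₁ : 1 ≤ p₁) (hq₀ : 0 ≤ q₀) (hq₁ : 0 ≤ q₁) {M₀ M₁ : ℝ≥0} (hT₀ : IsWeakType T p₀ q₀ M₀)
    (hT₁ : IsWeakType T p₁ q₁ M₁) (f : X →ₘ[μ] ℝ) (k : ℤ) (x : ℝ) {A₀ A₁ : ℝ≥0∞}
    (hA₀ : A₀ ≠ ∞) (hA₁ : A₁ ≠ ∞) (hk : decreasingRearrangement f μ (2 ^ (k : ℝ)) ≠ ∞)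
    (h₀ : ∑' j : ℤ, (if j ≤ k then (2 : ℝ≥0∞) ^ (j / p₀)
      * decreasingRearrangement f μ (2 ^ (j : ℝ)) else 0) ≤ A₀)
    (h₁ : ∑' j : ℤ, (if k ≤ j then (2 : ℝ≥0∞) ^ (j / p₁)
      * decreasingRearrangement f μ (2 ^ (j : ℝ)) else 0) ≤ A₁) :
    decreasingRearrangement (T f) ν (2 * 2 ^ x) ≤ M₀ * 2 ^ (-(x / q₀)) * A₀
      + M₁ * 2 ^ (-(x / q₁)) * (ENNReal.ofReal (2 * p₁) * A₁ + A₁) := by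
  set r := (decreasingRearrangement f μ (2 ^ (k : ℝ))).toNNReal with hr
  have hrk : (r : ℝ≥0∞) = decreasingRearrangement f μ (2 ^ (k : ℝ)) := ENNReal.coe_toNNReal hk
  obtain ⟨g, h, rfl, hg, hg0, hh, hhr⟩ := f.exists_eq_add_of_enorm_le r
  set F : ℤ → ℝ≥0∞ := fun j => decreasingRearrangement ⇑(g + h) μ (2 ^ (j : ℝ)) with hF
  -- The tall part g lives on {|f| > f*(2^k)}, whose measure is at most 2^k.
  have hgzero : ∀ j : ℤ, ¬ j ≤ k → decreasingRearrangement g μ (2 ^ (j : ℝ)) = 0 := by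
    intro j hj
    refine le_antisymm (decreasingRearrangement_le_iff.2 ?_) (zero_le)
    refine (measure_mono_ae (t := {x | (r : ℝ≥0∞) < ‖(g + h) x‖ₑ}) ?_).trans
      ((decreasingRearrangement_le_iff.1 hrk.ge).trans (ENNReal.ofReal_le_ofReal ?_))
    · filter_upwards [hg0] with x hx hpos
      by_contra hcon
      have := hx (not_lt.1 hcon)
      have hpos' : 0 < ‖g x‖ₑ := hpos
      simp [this] at hpos'
    · refine Real.rpow_le_rpow_of_exponent_le (by norm_num) ?_
      exact_mod_cast (not_le.1 hj).le
  have hgnorm : lorentzNorm g (ENNReal.ofReal p₀) 1 μ ≤ A₀ := by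
    refine (lorentzNorm_one_le_tsum _ hp₀).trans (le_trans (ENNReal.tsum_le_tsum fun j => ?_) h₀)
    split_ifs with hj
    · exact mul_le_mul_right (decreasingRearrangement_mono_ae hg _) _
    · rw [hgzero j hj, mul_zero]
  have hp₁' : 0 < p₁ := one_pos.trans_le hp₁
  -- The term j = k of the right-hand sum; it absorbs the geometric series over j ≤ k, where h* is
  -- only bounded by r.
  have hterm : 2 ^ ((k : ℝ) / p₁) * (r : ℝ≥0∞) ≤ A₁ := by
    refine le_trans (le_of_eq ?_) ((ENNReal.le_tsum k).trans h₁)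
    rw [if_pos le_rfl, hrk]
  have hhnorm : lorentzNorm h (ENNReal.ofReal p₁) 1 μ ≤ ENNReal.ofReal (2 * p₁) * A₁ + A₁ := by
    refine (lorentzNorm_one_le_tsum _ hp₁).trans ?_
    calc ∑' j : ℤ, (2 : ℝ≥0∞) ^ (j / p₁) * decreasingRearrangement h μ (2 ^ (j : ℝ))
        ≤ ∑' j : ℤ, ((if j ≤ k then (2 : ℝ≥0∞) ^ (1 / p₁ * j) else 0) * r
            + if k ≤ j then (2 : ℝ≥0∞) ^ (j / p₁) * F j else 0) := by
          refine ENNReal.tsum_le_tsum fun j => ?_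
          rcases le_total j k with hj | hj
          · rw [if_pos hj, one_div_mul_eq_div]
            refine le_add_right (mul_le_mul_right (decreasingRearrangement_le_iff.2 ?_) _)
            refine le_of_eq_of_le (measure_eq_zero_iff_ae_notMem.2 ?_) zero_le
            filter_upwards [hhr] with x hx
            exact not_lt.2 hx
          · rw [if_pos hj]
            exact le_add_left (mul_le_mul_right (decreasingRearrangement_mono_ae hh _) _)
      _ = (∑' j : ℤ, (if j ≤ k then (2 : ℝ≥0∞) ^ (1 / p₁ * j) else 0)) * r
            + ∑' j : ℤ, (if k ≤ j then (2 : ℝ≥0∞) ^ (j / p₁) * F j else 0) := by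
          rw [ENNReal.tsum_add, ENNReal.tsum_mul_right]
      _ ≤ ENNReal.ofReal (2 * p₁) * A₁ + A₁ := by
          refine add_le_add ?_ h₁
          have hs := tsum_int_le_two_rpow_mul_le (α := 1 / p₁) (by positivity)
            ((div_le_one hp₁').2 hp₁) k
          rw [one_div_mul_eq_div, show 2 / (1 / p₁) = 2 * p₁ by field_simp] at hs
          refine (mul_le_mul_left hs _).trans ?_
          rw [mul_assoc]
          gcongr
  -- The argument 2·2^x is shared equally between the two summands.
  have hadd : decreasingRearrangement (T (g + h)) ν (2 * 2 ^ x)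
      ≤ decreasingRearrangement (T g) ν (2 ^ x) + decreasingRearrangement (T h) ν (2 ^ x) := by
    rw [map_add, two_mul]
    refine le_trans (decreasingRearrangement_mono_ae (g := ⇑(T g) + ⇑(T h)) ?_ _)
      (decreasingRearrangement_add_le _ _ (by positivity) (by positivity))
    filter_upwards [AEEqFun.coeFn_add (T g) (T h)] with y hy
    rw [hy]
  refine hadd.trans (add_le_add (hT₀.decreasingRearrangement_le hq₀ hA₀ hgnorm x)
    (hT₁.decreasingRearrangement_le hq₁ ?_ hhnorm x))
  exact ENNReal.add_ne_top.2 ⟨ENNReal.mul_ne_top ENNReal.ofReal_ne_top hA₁, hA₁⟩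

/-- The relations for β make all powers of 2 cancel when Tf is sampled at 2·2^(βk); the bounds on α
replace both one-sided kernels by 2^(-α|n|). The constant depends on p and q only through α and β.
-/
theorem eLpNorm_le_of_isWeakType {p₀ p₁ q₀ q₁ p q α β : ℝ} (hp₀ : 1 ≤ p₀)
    (hp₁ : 1 ≤ p₁) (hq₀ : 0 ≤ q₀) (hq₁ : 0 ≤ q₁) (hp : 1 < p) (hpq : p ≤ q) (hα : 0 < α)
    (hα1 : α ≤ 1) (hβ : 0 < β) (hα₀ : α ≤ 1 / p₀ - 1 / p) (hα₁ : α ≤ 1 / p - 1 / p₁)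
    (hβ₀ : β * (1 / q₀ - 1 / q) = 1 / p₀ - 1 / p) (hβ₁ : β * (1 / q - 1 / q₁) = 1 / p - 1 / p₁)
    {M₀ M₁ : ℝ≥0} (hT₀ : IsWeakType T p₀ q₀ M₀) (hT₁ : IsWeakType T p₁ q₁ M₁) (f : X →ₘ[μ] ℝ)
    (hf : eLpNorm f (ENNReal.ofReal p) μ ≠ ∞) :
    eLpNorm (T f) (ENNReal.ofReal q) ν
      ≤ ENNReal.ofReal (2 ^ (2 + β) * (2 * p₁ + 2) * (4 / α)) * (max M₀ M₁ : ℝ≥0)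
        * eLpNorm f (ENNReal.ofReal p) μ := by
  have hp0 : 0 < p := one_pos.trans hp
  have hq0 : 0 < q := hp0.trans_le hpq
  set F : ℤ → ℝ≥0∞ := fun j => decreasingRearrangement f μ (2 ^ (j : ℝ)) with hF
  set a : ℤ → ℝ≥0∞ := fun j => 2 ^ (j / p : ℝ) * F j with ha
  set K : ℤ → ℝ≥0∞ := fun n => 2 ^ (-(α * |(n : ℝ)|)) with hK
  set Φ : ℤ → ℝ≥0∞ := fun k => ∑' j, K (k - j) * a j with hΦ
  set N := eLpNorm f (ENNReal.ofReal p) μ with hN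
  have hNp : ∫⁻ x, ‖f x‖ₑ ^ p ∂μ = N ^ p := by
    rw [hN, eLpNorm_eq_lintegral_rpow_enorm_toReal (by simpa using hp0) ENNReal.ofReal_ne_top,
      ENNReal.toReal_ofReal hp0.le, ← ENNReal.rpow_mul, one_div_mul_cancel hp0.ne',
      ENNReal.rpow_one]
  have hasum : ∑' j, a j ^ p ≤ 2 * N ^ p := by
    rw [← hNp]
    refine le_trans (le_of_eq (tsum_congr fun j => ?_))
      (tsum_two_rpow_mul_decreasingRearrangement_rpow_le f.aemeasurable hp0)
    rw [ha, ENNReal.mul_rpow_of_nonneg _ _ hp0.le, ← ENNReal.rpow_mul, div_mul_cancel₀ _ hp0.ne']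
  have hΦsum : ∑' k, Φ k ^ p ≤ (ENNReal.ofReal (4 / α) * 2 * N) ^ p := by
    refine (ENNReal.tsum_conv_rpow_le hp K a).trans ?_
    rw [ENNReal.mul_rpow_of_nonneg _ _ hp0.le, ENNReal.mul_rpow_of_nonneg _ _ hp0.le, mul_assoc]
    gcongr
    · exact ENNReal.tsum_int_two_rpow_neg_mul_abs_le hα hα1
    · refine hasum.trans (mul_le_mul_left ?_ _)
      exact ENNReal.le_rpow_self_of_one_le (by norm_num) hp.le
  -- Needed to truncate at the height f*(2^k) and to apply the weak types, which assume finite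
  -- Lorentz norms.
  have hfin : ∀ k, Φ k ≠ ∞ := by
    intro k hk
    have h1 : Φ k ^ p ≤ (ENNReal.ofReal (4 / α) * 2 * N) ^ p := (ENNReal.le_tsum k).trans hΦsum
    rw [hk, ENNReal.top_rpow_of_pos hp0, top_le_iff] at h1
    exact ENNReal.rpow_ne_top_of_nonneg hp0.le (by finiteness) h1
  have hpoint : ∀ k : ℤ, (2 : ℝ≥0∞) ^ (β * k / q) * decreasingRearrangement (T f) ν (2 * 2 ^ (β * k))
      ≤ ENNReal.ofReal (2 * p₁ + 2) * (max M₀ M₁ : ℝ≥0) * Φ k := by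
    intro k
    have hFa : ∀ (j : ℤ) (u : ℝ), (2 : ℝ≥0∞) ^ (j / u) * F j = 2 ^ (j * (1 / u - 1 / p)) * a j := by
      intro j u
      rw [ha, ← mul_assoc, ← ENNReal.two_rpow_add]
      congr 2
      ring
    have hpow : ∀ k : ℤ, ∀ u : ℝ, (2 : ℝ≥0∞) ^ (k * u) ≠ ∞ := fun k u =>
      ENNReal.rpow_ne_top_of_ne_zero (by norm_num) (by norm_num)
    have hakF : F k ≠ ∞ := by
      have h1 : a k ≤ Φ k := by
        refine le_trans (le_of_eq ?_) (ENNReal.le_tsum k)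
        simp [hK]
      intro hcon
      refine hfin k (top_le_iff.1 (le_trans (le_of_eq ?_) h1))
      rw [ha]
      simp only [hcon]
      rw [ENNReal.mul_top]
      exact (ENNReal.rpow_pos (by norm_num) (by norm_num)).ne'
    have h₀ : ∑' j : ℤ, (if j ≤ k then (2 : ℝ≥0∞) ^ (j / p₀) * F j else 0)
        ≤ 2 ^ (k * (1 / p₀ - 1 / p)) * Φ k := by
      rw [hΦ, ← ENNReal.tsum_mul_left]
      refine ENNReal.tsum_le_tsum fun j => ?_
      split_ifs with hj
      · rw [hFa]
        have hexp : (2 : ℝ≥0∞) ^ (j * (1 / p₀ - 1 / p)) ≤ 2 ^ (k * (1 / p₀ - 1 / p)) * K (k - j) := by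
          rw [hK, ← ENNReal.two_rpow_add]
          refine ENNReal.rpow_le_rpow_of_exponent_le (by norm_num) ?_
          have hj' : (j : ℝ) ≤ k := by exact_mod_cast hj
          push_cast
          rw [abs_of_nonneg (by linarith)]
          nlinarith
        exact (mul_le_mul_left hexp _).trans_eq (mul_assoc _ _ _)
      · exact zero_le
    have h₁ : ∑' j : ℤ, (if k ≤ j then (2 : ℝ≥0∞) ^ (j / p₁) * F j else 0)
        ≤ 2 ^ (k * (1 / p₁ - 1 / p)) * Φ k := by
      rw [hΦ, ← ENNReal.tsum_mul_left]
      refine ENNReal.tsum_le_tsum fun j => ?_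
      split_ifs with hj
      · rw [hFa]
        have hexp : (2 : ℝ≥0∞) ^ (j * (1 / p₁ - 1 / p)) ≤ 2 ^ (k * (1 / p₁ - 1 / p)) * K (k - j) := by
          rw [hK, ← ENNReal.two_rpow_add]
          refine ENNReal.rpow_le_rpow_of_exponent_le (by norm_num) ?_
          have hj' : (k : ℝ) ≤ j := by exact_mod_cast hj
          push_cast
          rw [abs_of_nonpos (by linarith)]
          nlinarith
        exact (mul_le_mul_left hexp _).trans_eq (mul_assoc _ _ _)
      · exact zero_le
    have hmain := decreasingRearrangement_two_mul_le_of_isWeakType hp₀ hp₁ hq₀ hq₁ hT₀ hT₁ f k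
      (β * k) (ENNReal.mul_ne_top (hpow k _) (hfin k)) (ENNReal.mul_ne_top (hpow k _) (hfin k))
      hakF h₀ h₁
    have hc₀ : (2 : ℝ≥0∞) ^ (β * k / q) * (2 ^ (-(β * k / q₀)) * 2 ^ (k * (1 / p₀ - 1 / p))) = 1 := by
      rw [← ENNReal.two_rpow_add, ← ENNReal.two_rpow_add, ← hβ₀, ← ENNReal.rpow_zero (x := 2)]
      congr 1
      ring
    have hc₁ : (2 : ℝ≥0∞) ^ (β * k / q) * (2 ^ (-(β * k / q₁)) * 2 ^ (k * (1 / p₁ - 1 / p))) = 1 := by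
      rw [← ENNReal.two_rpow_add, ← ENNReal.two_rpow_add, ← neg_sub (1 / p), ← hβ₁,
        ← ENNReal.rpow_zero (x := 2)]
      congr 1
      ring
    have hsum : ENNReal.ofReal (2 * p₁ + 2) = 1 + (ENNReal.ofReal (2 * p₁) + 1) := by
      rw [show 2 * p₁ + 2 = 2 * p₁ + 1 + 1 by ring, ENNReal.ofReal_add (by positivity) one_pos.le,
        ENNReal.ofReal_add (by positivity) one_pos.le, ENNReal.ofReal_one, add_comm]
    calc _ ≤ (2 : ℝ≥0∞) ^ (β * k / q) * _ := mul_le_mul_right hmain _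
      _ = M₀ * Φ k * (2 ^ (β * k / q) * (2 ^ (-(β * k / q₀)) * 2 ^ (k * (1 / p₀ - 1 / p))))
          + M₁ * ((ENNReal.ofReal (2 * p₁) + 1) * Φ k)
            * (2 ^ (β * k / q) * (2 ^ (-(β * k / q₁)) * 2 ^ (k * (1 / p₁ - 1 / p)))) := by ring
      _ = M₀ * Φ k + M₁ * ((ENNReal.ofReal (2 * p₁) + 1) * Φ k) := by
        rw [hc₀, hc₁, mul_one, mul_one]
      _ ≤ (max M₀ M₁ : ℝ≥0) * Φ k
          + (max M₀ M₁ : ℝ≥0) * ((ENNReal.ofReal (2 * p₁) + 1) * Φ k) := by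
        gcongr
        · exact le_max_left _ _
        · exact le_max_right _ _
      _ = ENNReal.ofReal (2 * p₁ + 2) * (max M₀ M₁ : ℝ≥0) * Φ k := by
        rw [hsum]
        ring
  set D : ℝ≥0∞ := ENNReal.ofReal (2 * p₁ + 2) * (max M₀ M₁ : ℝ≥0) with hD
  have hint : ∫⁻ y, ‖T f y‖ₑ ^ q ∂ν ≤ 2 ^ (1 + β) * (D * (ENNReal.ofReal (4 / α) * 2 * N)) ^ q := by
    calc ∫⁻ y, ‖T f y‖ₑ ^ q ∂ν
        ≤ ∑' k : ℤ, ENNReal.ofReal (2 * 2 ^ (β * (k + 1)))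
          * decreasingRearrangement (T f) ν (2 * 2 ^ (β * k)) ^ q :=
          lintegral_rpow_le_tsum_decreasingRearrangement_rpow (T f).aemeasurable hq0 hβ two_pos
      _ = ∑' k : ℤ, 2 ^ (1 + β) * ((2 : ℝ≥0∞) ^ (β * k / q)
          * decreasingRearrangement (T f) ν (2 * 2 ^ (β * k))) ^ q := by
          refine tsum_congr fun k => ?_
          rw [ENNReal.mul_rpow_of_nonneg _ _ hq0.le, ← ENNReal.rpow_mul, div_mul_cancel₀ _ hq0.ne',
            ← mul_assoc, ← ENNReal.two_rpow_add, ← ENNReal.ofReal_two_rpow, mul_add, mul_one,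
            show 1 + β + β * k = β * k + β + 1 by ring, Real.rpow_add_one (by norm_num),
            mul_comm (2 : ℝ)]
      _ ≤ ∑' k : ℤ, 2 ^ (1 + β) * (D ^ q * (Φ k ^ p) ^ (q / p)) := by
          refine ENNReal.tsum_le_tsum fun k => ?_
          rw [← ENNReal.rpow_mul, mul_div_cancel₀ _ hp0.ne', ← ENNReal.mul_rpow_of_nonneg _ _ hq0.le]
          exact mul_le_mul_right (ENNReal.rpow_le_rpow (hpoint k) hq0.le) _
      _ = 2 ^ (1 + β) * (D ^ q * ∑' k : ℤ, (Φ k ^ p) ^ (q / p)) := by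
          rw [ENNReal.tsum_mul_left, ENNReal.tsum_mul_left]
      _ ≤ 2 ^ (1 + β) * (D ^ q * ((ENNReal.ofReal (4 / α) * 2 * N) ^ p) ^ (q / p)) := by
          gcongr
          refine (ENNReal.tsum_rpow_le_rpow_tsum ((one_le_div hp0).2 hpq) _).trans ?_
          exact ENNReal.rpow_le_rpow hΦsum (by positivity)
      _ = _ := by
          rw [← ENNReal.rpow_mul, mul_div_cancel₀ _ hp0.ne', ← ENNReal.mul_rpow_of_nonneg _ _ hq0.le]
  rw [eLpNorm_eq_lintegral_rpow_enorm_toReal (by simpa using hq0) ENNReal.ofReal_ne_top,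
      ENNReal.toReal_ofReal hq0.le]
  calc (∫⁻ y, ‖T f y‖ₑ ^ q ∂ν) ^ (1 / q)
      ≤ (2 ^ (1 + β) * (D * (ENNReal.ofReal (4 / α) * 2 * N)) ^ q) ^ (1 / q) := by gcongr
    _ = 2 ^ ((1 + β) * (1 / q)) * (D * (ENNReal.ofReal (4 / α) * 2 * N)) := by
        rw [ENNReal.mul_rpow_of_nonneg _ _ (by positivity), ← ENNReal.rpow_mul, ← ENNReal.rpow_mul,
          mul_one_div_cancel hq0.ne', ENNReal.rpow_one]
    -- Since q ≥ 1, the root 1/q can be dropped, removing q from the constant.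
    _ ≤ 2 ^ (1 + β) * (D * (ENNReal.ofReal (4 / α) * 2 * N)) := by
        gcongr
        · norm_num
        · refine mul_le_of_le_one_right (by positivity) ?_
          rw [div_le_one hq0]
          exact hp.le.trans hpq
    _ = _ := by
        rw [ENNReal.ofReal_mul (by positivity), ENNReal.ofReal_mul (by positivity),
          ENNReal.ofReal_two_rpow, hD, show 2 + β = 1 + β + 1 by ring,
          ENNReal.two_rpow_add (1 + β), ENNReal.rpow_one]
        ring

end WeakType

/-! ### The exponent r_RT(q) -/

section Exponents

variable {p₀ p₁ q₀ q₁ q : ℝ}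

/-- The point (1/q, 1/r_RT(q)) lies on the line through (1/q_i, 1/p_i). -/
theorem one_div_sub_one_div_rRT (hp₀ : 0 < p₀) (hp₁ : 0 < p₁) (hq₀ : 0 < q₀) (hq₁ : 0 < q₁)
    (hq : q ∈ Set.Ioo q₀ q₁) :
    (1 / p₀ - 1 / p₁) / (1 / q₀ - 1 / q₁) * (1 / q₀ - 1 / q)
        = 1 / p₀ - 1 / rRT p₀ p₁ q₀ q₁ q ∧
      (1 / p₀ - 1 / p₁) / (1 / q₀ - 1 / q₁) * (1 / q - 1 / q₁)
        = 1 / rRT p₀ p₁ q₀ q₁ q - 1 / p₁ := by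
  have hq0 : 0 < q := hq₀.trans hq.1
  have h01 : q₁ - q₀ ≠ 0 := by linarith [hq.1, hq.2]
  have hdiv : 1 / rRT p₀ p₁ q₀ q₁ q
      = (p₀ * q₁ * (q - q₀) + p₁ * q₀ * (q₁ - q)) / (p₀ * p₁ * (q₁ - q₀) * q) := by
    rw [rRT, one_div_div]
  have hb : 1 / q₀ - 1 / q₁ = (q₁ - q₀) / (q₀ * q₁) := by field_simp
  rw [hdiv, hb]
  constructor
  · field_simp
    ring
  · field_simp
    ring

theorem rRT_mem_Ioo (hp₀ : 0 < p₀) (hp : p₀ < p₁) (hq₀ : 0 < q₀) (hq : q ∈ Set.Ioo q₀ q₁) :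
    rRT p₀ p₁ q₀ q₁ q ∈ Set.Ioo p₀ p₁ := by
  have hp₁ : 0 < p₁ := hp₀.trans hp
  have hq0 : 0 < q := hq₀.trans hq.1
  have hq₁ : 0 < q₁ := hq0.trans hq.2
  have h1 : 0 < q - q₀ := sub_pos.2 hq.1
  have h2 : 0 < q₁ - q := sub_pos.2 hq.2
  have h3 : 0 < p₁ - p₀ := sub_pos.2 hp
  have hden : 0 < p₀ * q₁ * (q - q₀) + p₁ * q₀ * (q₁ - q) := by positivity
  have e1 : 0 < p₀ * q₁ * ((p₁ - p₀) * (q - q₀)) := by positivity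
  have e2 : 0 < p₁ * q₀ * ((p₁ - p₀) * (q₁ - q)) := by positivity
  constructor
  · rw [rRT, lt_div_iff₀ hden]
    nlinarith
  · rw [rRT, div_lt_iff₀ hden]
    nlinarith

/-- The inequalities 1/p_i ≥ 1/q_i are averaged with the same weights. -/
theorem rRT_le (hp₀ : 0 < p₀) (hp₁ : 0 < p₁) (hpq₀ : p₀ ≤ q₀) (hpq₁ : p₁ ≤ q₁)
    (hq : q ∈ Set.Ioo q₀ q₁) : rRT p₀ p₁ q₀ q₁ q ≤ q := by
  have hq₀ : 0 < q₀ := hp₀.trans_le hpq₀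
  have hq₁ : 0 < q₁ := hp₁.trans_le hpq₁
  have hq0 : 0 < q := hq₀.trans hq.1
  have h1 : 0 < q - q₀ := sub_pos.2 hq.1
  have h2 : 0 < q₁ - q := sub_pos.2 hq.2
  have hden : 0 < p₀ * q₁ * (q - q₀) + p₁ * q₀ * (q₁ - q) := by positivity
  rw [rRT, div_le_iff₀ hden, mul_comm _ q]
  refine mul_le_mul_of_nonneg_left ?_ hq0.le
  have e1 : p₀ * p₁ * (q - q₀) ≤ p₀ * q₁ * (q - q₀) := by gcongr
  have e2 : p₁ * p₀ * (q₁ - q) ≤ p₁ * q₀ * (q₁ - q) := by gcongr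
  linarith

end Exponents

/-! ### The Grand Lebesgue estimate -/

theorem theorem5p2 (p₀ p₁ q₀ q₁ : ℝ) (hp₀ : 1 ≤ p₀) (hp : p₀ < p₁) (hq₀ : 1 ≤ q₀)
    (hq : q₀ < q₁) (hpq₀ : p₀ ≤ q₀) (hpq₁ : p₁ ≤ q₁) :
    ∃ C : ℝ≥0, 0 < C ∧
      ∀ (X Y : Type*) [MeasurableSpace X] [MeasurableSpace Y]
        (μ : Measure X) (ν : Measure Y) [SigmaFinite μ] [SigmaFinite ν]
        (T : (X →ₘ[μ] ℝ) →ₗ[ℝ] (Y →ₘ[ν] ℝ)) (M₀ M₁ : ℝ≥0),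
        IsWeakType T p₀ q₀ M₀ → IsWeakType T p₁ q₁ M₁ →
        ∀ ψ : ℝ → ℝ, IsPsiFunction p₀ p₁ ψ →
        ∀ f : X →ₘ[μ] ℝ, glsNorm p₀ p₁ ψ f μ < ∞ →
          glsNorm q₀ q₁ (psiM p₀ p₁ q₀ q₁ ψ) (T f) ν
            ≤ C * (max M₀ M₁ : ℝ≥0) * glsNorm p₀ p₁ ψ f μ := by
  have hp₀' : 0 < p₀ := one_pos.trans_le hp₀
  have hp₁' : 0 < p₁ := hp₀'.trans hp
  have hq₀' : 0 < q₀ := one_pos.trans_le hq₀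
  have hq₁' : 0 < q₁ := hq₀'.trans hq
  set β := (1 / p₀ - 1 / p₁) / (1 / q₀ - 1 / q₁) with hβdef
  have hβ : 0 < β :=
    div_pos (sub_pos.2 (one_div_lt_one_div_of_lt hp₀' hp)) (sub_pos.2 (one_div_lt_one_div_of_lt hq₀' hq))
  have hqq : 0 < q₁ - q₀ := sub_pos.2 hq
  -- The gaps are β(q - q₀)/(q₀q) and β(q₁ - q)/(qq₁). Their denominators are at most q₁², and the
  -- factor missing from each is at most q₁ - q₀, so c(q - q₀)(q₁ - q) lies below both.
  set c := β / (q₁ ^ 2 * (q₁ - q₀)) with hcdef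
  have hc : 0 < c := by positivity
  set A := 2 ^ (2 + β) * (2 * p₁ + 2) * (4 / c) with hA
  have hA0 : 0 < A := by positivity
  refine ⟨A.toNNReal, Real.toNNReal_pos.2 hA0, ?_⟩
  intro X Y _ _ μ ν _ _ T M₀ M₁ hT₀ hT₁ ψ hψ f hf
  refine iSup₂_le fun q hqmem => ?_
  obtain ⟨hq1, hq2⟩ := hqmem
  have hq0 : 0 < q := hq₀'.trans hq1
  have h1 : 0 < q - q₀ := sub_pos.2 hq1
  have h2 : 0 < q₁ - q := sub_pos.2 hq2
  obtain ⟨hβ₀, hβ₁⟩ := one_div_sub_one_div_rRT hp₀' hp₁' hq₀' hq₁' ⟨hq1, hq2⟩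
  have hpmem := rRT_mem_Ioo hp₀' hp hq₀' ⟨hq1, hq2⟩
  have hpq := rRT_le hp₀' hp₁' hpq₀ hpq₁ ⟨hq1, hq2⟩
  rw [psiM]
  set p := rRT p₀ p₁ q₀ q₁ q with hpdef
  rw [← hβdef] at hβ₀ hβ₁
  have hp1 : 1 < p := hp₀.trans_lt hpmem.1
  have hψp : 0 < ψ p := by
    obtain ⟨b, hb, hbψ⟩ := hψ.exists_pos_le
    exact hb.trans_le (hbψ p hpmem)
  have hfp : eLpNorm f (ENNReal.ofReal p) μ ≤ glsNorm p₀ p₁ ψ f μ * ENNReal.ofReal (ψ p) := by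
    rw [← ENNReal.div_le_iff (by simpa using hψp) ENNReal.ofReal_ne_top]
    exact le_iSup₂ (f := fun p (_ : p ∈ Set.Ioo p₀ p₁) =>
      eLpNorm f (ENNReal.ofReal p) μ / ENNReal.ofReal (ψ p)) p hpmem
  set α := c * ((q - q₀) * (q₁ - q)) with hα
  have hα0 : 0 < α := by positivity
  have hα₀ : α ≤ 1 / p₀ - 1 / p := by
    rw [← hβ₀, hα, hcdef, div_mul_eq_mul_div, mul_div_assoc]
    refine mul_le_mul_of_nonneg_left ?_ hβ.le
    rw [div_sub_div _ _ hq₀'.ne' hq0.ne', div_le_div_iff₀ (by positivity) (by positivity)]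
    have e1 : q₀ * q ≤ q₁ ^ 2 := by nlinarith
    have e2 : (q₁ - q) * (q₀ * q) ≤ (q₁ - q₀) * q₁ ^ 2 := by gcongr
    nlinarith
  have hα₁ : α ≤ 1 / p - 1 / p₁ := by
    rw [← hβ₁, hα, hcdef, div_mul_eq_mul_div, mul_div_assoc]
    refine mul_le_mul_of_nonneg_left ?_ hβ.le
    rw [div_sub_div _ _ hq0.ne' hq₁'.ne', div_le_div_iff₀ (by positivity) (by positivity)]
    have e1 : q * q₁ ≤ q₁ ^ 2 := by nlinarith
    have e2 : (q - q₀) * (q * q₁) ≤ (q₁ - q₀) * q₁ ^ 2 := by gcongr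
    nlinarith
  have hα1 : α ≤ 1 := by
    have e1 : 1 / p₀ ≤ 1 := (div_le_one hp₀').2 hp₀
    have e2 : 0 < 1 / p := by positivity
    linarith
  have hmain := eLpNorm_le_of_isWeakType hp₀ (hp₀.trans hp.le) hq₀'.le hq₁'.le hp1 hpq hα0 hα1 hβ
    hα₀ hα₁ hβ₀ hβ₁ hT₀ hT₁ f (ne_top_of_le_ne_top (ENNReal.mul_ne_top hf.ne ENNReal.ofReal_ne_top) hfp)
  have hψM : 0 < ψ p * ((q - q₀) * (q₁ - q))⁻¹ := by positivity
  rw [ENNReal.div_le_iff (by simpa using hψM) ENNReal.ofReal_ne_top]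
  refine hmain.trans ((mul_le_mul_right hfp _).trans (le_of_eq ?_))
  -- The kernel norm 4/α is what produces the poles of ψ_M at q₀ and q₁.
  have hconst : 2 ^ (2 + β) * (2 * p₁ + 2) * (4 / α) = A * ((q - q₀) * (q₁ - q))⁻¹ := by
    rw [hA, hα]
    field_simp
  rw [hconst, ENNReal.ofReal_mul hA0.le, ENNReal.ofReal_mul hψp.le]
  change _ = ENNReal.ofReal A * _ * _ * _
  ring
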